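/- Let $M$ be a type II$_1$ factor with its faithful normal normalized trace $\tau$ and $\|x\|_2=\tau(x^*x)^{1/2}$, and let $N\subset M$ be a (unital) type II$_1$ subfactor. For a free ultrafilter $\omega$ on $\mathbb N$, let $M^\omega=\ell^\infty(\mathbb N,M)/I_\omega$ with $I_\omega=\{(a_n):\lim_{n\to\omega}\|a_n\|_2=0\}$, where $M$ is embedded in $M^\omega$ by constant sequences; for a von Neumann subalgebra $P\subset M$, let $P^\omega\subset M^\omega$ be the set of classes of bounded sequences in $P$. Suppose that $N$ has property (T) in the sense of Connes and Jones: there are $y_1,\dots,y_m\in N$ and constants $\varepsilon,K>0$ such that, for every $0<\delta<\varepsilon$, whenever an $N$-bimodule $\mathcal H$ (a Hilbert space with commuting normal unital $*$-representations of $N$ and of $N^{op}$) contains a unit vector $\xi$ with $\max_j\|y_j\xi-\xi y_j\|<\delta$, there is a unit vector $\eta\in\mathcal H$ with $x\eta=\eta x$ for all $x\in N$ and $\|\eta-\xi\|<K\delta$. Then $N'\cap M^\omega=(N'\cap M)^\omega$ for every free ultrafilter $\omega$ on $\mathbb N$. In particular, if $N$ is irreducible in $M$ (that is, $N'\cap M\subset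 N$), then $N'\cap M^\omega=\mathbb C$ for every free ultrafilter $\omega$, and $N$ does not have property gamma relative to $M$; here $N$ has property gamma relative to $M$ if, for every finite set $F\subset N$, there is a bounded sequence $(x_n)\subset M$ such that $\|x_n\|_2=1$ and $\mathbb E_N(x_n)=0$ for every $n$, and $\|yx_n-x_ny\|_2\to0$ for every $y\in F$, where $\mathbb E_N$ is the $\tau$-preserving conditional expectation of $M$ onto $N$. -/

import Mathlib

open Filter Topology MulOpposite

universe u

namespace IIOne

variable {H : Type u} [NormedAddCommGroup H] [InnerProductSpace ℂ H] [CompleteSpace H]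

/-- The `*`-algebra of elements of a von Neumann algebra `M ⊆ B(H)` (with the operator norm). -/
abbrev Elt (M : VonNeumannAlgebra H) : Type u := ↥M.toStarSubalgebra

/-- A positive functional `φ` on `M` is normal: it is a sum of vector functionals
`x ↦ ∑ₙ ⟪ξₙ, x ξₙ⟫` with `∑ₙ ‖ξₙ‖² < ∞`, that is, it is positive and `σ`-weakly continuous. -/
def IsNormalPositive (M : VonNeumannAlgebra H) (φ : Elt M → ℂ) : Prop :=
  ∃ ξ : ℕ → H, Summable (fun n => ‖ξ n‖ ^ 2) ∧
    ∀ x : Elt M, φ x = ∑' n, inner ℂ (ξ n) ((x : H →L[ℂ] H) (ξ n))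

/-- A faithful normal normalized trace on `M` (positivity is part of `normal`). -/
structure NormalTrace (M : VonNeumannAlgebra H) where
  toLin : Elt M →ₗ[ℂ] ℂ
  map_one : toLin 1 = 1
  tracial : ∀ x y : Elt M, toLin (x * y) = toLin (y * x)
  faithful : ∀ x : Elt M, toLin (star x * x) = 0 → x = 0
  normal : IsNormalPositive M toLin

/-- `M` is a factor: its center consists of the scalars. -/
def IsFactor (M : VonNeumannAlgebra H) : Prop :=
  ∀ x ∈ M, x ∈ M.commutant → ∃ c : ℂ, x = c • (1 : H →L[ℂ] H)

/-- A factor of type II₁: an infinite-dimensional factor with a faithful normal normalized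
trace. -/
def IsTypeIIOneFactor (M : VonNeumannAlgebra H) : Prop :=
  IsFactor M ∧ ¬ FiniteDimensional ℂ (Elt M) ∧ Nonempty (NormalTrace M)

/-- An `N`-`N`-bimodule (a correspondence) on the Hilbert space `K`: commuting unital normal
`*`-representations of `N` and of the opposite algebra of `N`. The right action is
`ξ · x = right (op x) ξ`. -/
structure Bimodule (N : VonNeumannAlgebra H) (K : Type u) [NormedAddCommGroup K]
    [InnerProductSpace ℂ K] [CompleteSpace K] where
  left : Elt N →⋆ₐ[ℂ] (K →L[ℂ] K)
  right : (Elt N)ᵐᵒᵖ →⋆ₐ[ℂ] (K →L[ℂ] K)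
  commute : ∀ (x y : Elt N) (ζ : K), left x (right (op y) ζ) = right (op y) (left x ζ)
  normal_left : ∀ ζ : K, IsNormalPositive N (fun x => inner ℂ ζ (left x ζ))
  normal_right : ∀ ζ : K, IsNormalPositive N (fun x => inner ℂ ζ (right (op x) ζ))

/-- Property (T) of a II₁ factor: there are `y₁, …, yₘ ∈ N` and `ε, C > 0` such that for every
`0 < δ < ε`, each unit vector `ξ` of an `N`-bimodule with `max ‖yⱼ ξ - ξ yⱼ‖ < δ` has a unit
vector `η` with `x η = η x` for all `x ∈ N` and `‖η - ξ‖ < C δ`. -/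
def HasPropertyT (N : VonNeumannAlgebra H) : Prop :=
  ∃ (m : ℕ) (y : Fin m → Elt N) (ε C : ℝ), 0 < ε ∧ 0 < C ∧
    ∀ δ : ℝ, 0 < δ → δ < ε →
    ∀ (K : Type u) [NormedAddCommGroup K] [InnerProductSpace ℂ K] [CompleteSpace K]
      (B : Bimodule N K) (ξ : K), ‖ξ‖ = 1 →
      (∀ j, ‖B.left (y j) ξ - B.right (op (y j)) ξ‖ < δ) →
      ∃ η : K, ‖η‖ = 1 ∧ (∀ x : Elt N, B.left x η = B.right (op x) η) ∧ ‖η - ξ‖ < C * δ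

/-- `N` is irreducible in `M`: `N' ∩ M ⊆ N`. -/
def IsIrreducibleIn (N M : VonNeumannAlgebra H) : Prop :=
  ∀ x ∈ M, x ∈ N.commutant → x ∈ N

/-- The relative commutant `N' ∩ M`. -/
noncomputable def relCommutant (N M : VonNeumannAlgebra H) : StarSubalgebra ℂ (H →L[ℂ] H) :=
  N.commutant.toStarSubalgebra ⊓ M.toStarSubalgebra

variable {M : VonNeumannAlgebra H}

/-- The norm `‖x‖₂ = τ(x* x)^(1/2)`. -/
noncomputable def norm₂ (τ : NormalTrace M) (x : Elt M) : ℝ :=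
  Real.sqrt (τ.toLin (star x * x)).re

/-- `e` is the value at `x` of the `τ`-preserving conditional expectation of `M` onto `N`: it is
the element of `N` with `τ(e y) = τ(x y)` for all `y ∈ N`. -/
def IsCondExp (τ : NormalTrace M) (N : VonNeumannAlgebra H) (x e : Elt M) : Prop :=
  (e : H →L[ℂ] H) ∈ N ∧
    ∀ y : Elt M, (y : H →L[ℂ] H) ∈ N → τ.toLin (e * y) = τ.toLin (x * y)

/-- There is at most one such element. -/
theorem IsCondExp.unique {τ : NormalTrace M} {N : VonNeumannAlgebra H} {x e f : Elt M}
    (he : IsCondExp τ N x e) (hf : IsCondExp τ N x f) : e = f := by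
  have hmem : ((star (e - f) : Elt M) : H →L[ℂ] H) ∈ N := by
    have : ((star (e - f) : Elt M) : H →L[ℂ] H)
        = star ((e : H →L[ℂ] H) - (f : H →L[ℂ] H)) := rfl
    rw [this]
    exact star_mem (sub_mem he.1 hf.1)
  have h : τ.toLin ((e - f) * star (e - f)) = 0 := by
    rw [sub_mul, map_sub, he.2 _ hmem, hf.2 _ hmem, sub_self]
  rw [τ.tracial] at h
  exact sub_eq_zero.mp (τ.faithful _ h)

/-- `N` has property gamma relative to `M`: for every finite `F ⊆ N` there is a bounded sequence
`(xₙ)` in `M` with `‖xₙ‖₂ = 1`, `E_N(xₙ) = 0` and `‖y xₙ - xₙ y‖₂ → 0` for every `y ∈ F`. -/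
def HasRelativeGamma (τ : NormalTrace M) (N : VonNeumannAlgebra H) : Prop :=
  ∀ F : Finset (Elt M), (∀ y ∈ F, (y : H →L[ℂ] H) ∈ N) →
    ∃ x : ℕ → Elt M, (∃ C : ℝ, ∀ n, ‖x n‖ ≤ C) ∧ (∀ n, norm₂ τ (x n) = 1) ∧
      (∀ n, IsCondExp τ N (x n) 0) ∧
      ∀ y ∈ F, Tendsto (fun n => norm₂ τ (y * x n - x n * y)) atTop (𝓝 0)

/-- `ℓ^∞(ℕ, M)`. -/
def BddSeq (M : VonNeumannAlgebra H) : Subalgebra ℂ (ℕ → Elt M) where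
  carrier := {x | ∃ C : ℝ, ∀ n, ‖x n‖ ≤ C}
  mul_mem' := by
    rintro x y ⟨C, hC⟩ ⟨D, hD⟩
    exact ⟨C * D, fun n => (norm_mul_le _ _).trans
      (mul_le_mul (hC n) (hD n) (norm_nonneg _) ((norm_nonneg _).trans (hC n)))⟩
  add_mem' := by
    rintro x y ⟨C, hC⟩ ⟨D, hD⟩
    exact ⟨C + D, fun n => (norm_add_le _ _).trans (add_le_add (hC n) (hD n))⟩
  algebraMap_mem' := fun c => ⟨‖algebraMap ℂ (Elt M) c‖, fun _ => le_rfl⟩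

/-- `‖x‖₂² = ∑ₙ ‖x ξₙ‖²` for the vectors `ξₙ` implementing the trace. -/
theorem NormalTrace.exists_vectors (τ : NormalTrace M) :
    ∃ ξ : ℕ → H, Summable (fun n => ‖ξ n‖ ^ 2) ∧
      ∀ x : Elt M, (norm₂ τ x) ^ 2 = ∑' n, ‖(x : H →L[ℂ] H) (ξ n)‖ ^ 2 := by
  obtain ⟨ξ, hξ, h⟩ := τ.normal
  refine ⟨ξ, hξ, fun x => ?_⟩
  have key : τ.toLin (star x * x) = ((∑' n, ‖(x : H →L[ℂ] H) (ξ n)‖ ^ 2 : ℝ) : ℂ) := by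
    rw [h, Complex.ofReal_tsum]
    refine tsum_congr fun n => ?_
    have : ((star x * x : Elt M) : H →L[ℂ] H)
        = ContinuousLinearMap.adjoint (x : H →L[ℂ] H) * (x : H →L[ℂ] H) := rfl
    rw [this, mul_apply_eq_comp, ContinuousLinearMap.adjoint_inner_right,
      inner_self_eq_norm_sq_to_K]
    simp
  rw [norm₂, key, Complex.ofReal_re, Real.sq_sqrt (tsum_nonneg fun n => sq_nonneg _)]

theorem summable_apply {ξ : ℕ → H} (hξ : Summable (fun n => ‖ξ n‖ ^ 2)) (x : H →L[ℂ] H) :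
    Summable (fun n => ‖x (ξ n)‖ ^ 2) := by
  refine Summable.of_nonneg_of_le (fun n => sq_nonneg _) (fun n => ?_) (hξ.mul_left (‖x‖ ^ 2))
  rw [← mul_pow]
  exact pow_le_pow_left₀ (norm_nonneg _) (x.le_opNorm _) 2

theorem norm₂_nonneg (τ : NormalTrace M) (x : Elt M) : 0 ≤ norm₂ τ x := Real.sqrt_nonneg _

theorem norm₂_star (τ : NormalTrace M) (x : Elt M) : norm₂ τ (star x) = norm₂ τ x := by
  rw [norm₂, norm₂, star_star, τ.tracial]

theorem norm₂_mul_le (τ : NormalTrace M) (x y : Elt M) :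
    norm₂ τ (x * y) ≤ ‖x‖ * norm₂ τ y := by
  obtain ⟨ξ, hξ, h⟩ := τ.exists_vectors
  refine le_of_sq_le_sq ?_ (mul_nonneg (norm_nonneg _) (norm₂_nonneg _ _))
  rw [mul_pow, h, h, ← tsum_mul_left]
  refine Summable.tsum_le_tsum (fun n => ?_) (summable_apply hξ _)
    ((summable_apply hξ _).mul_left _)
  rw [← mul_pow]
  exact pow_le_pow_left₀ (norm_nonneg _) ((x : H →L[ℂ] H).le_opNorm _) 2

theorem norm₂_mul_le' (τ : NormalTrace M) (x y : Elt M) :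
    norm₂ τ (x * y) ≤ ‖y‖ * norm₂ τ x := by
  rw [← norm₂_star τ (x * y), star_mul, ← norm₂_star τ x, ← norm_star y]
  exact norm₂_mul_le τ _ _

theorem norm₂_add_sq_le (τ : NormalTrace M) (x y : Elt M) :
    norm₂ τ (x + y) ^ 2 ≤ 2 * norm₂ τ x ^ 2 + 2 * norm₂ τ y ^ 2 := by
  obtain ⟨ξ, hξ, h⟩ := τ.exists_vectors
  rw [h, h, h, ← tsum_mul_left, ← tsum_mul_left,
    ← ((summable_apply hξ _).mul_left 2).tsum_add ((summable_apply hξ _).mul_left 2)]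
  refine Summable.tsum_le_tsum (fun n => ?_) (summable_apply hξ _)
    (((summable_apply hξ _).mul_left 2).add ((summable_apply hξ _).mul_left 2))
  have h1 := norm_add_le ((x : H →L[ℂ] H) (ξ n)) ((y : H →L[ℂ] H) (ξ n))
  have h2 : ((x + y : Elt M) : H →L[ℂ] H) (ξ n)
      = (x : H →L[ℂ] H) (ξ n) + (y : H →L[ℂ] H) (ξ n) := rfl
  rw [h2]
  nlinarith [norm_nonneg ((x : H →L[ℂ] H) (ξ n) + (y : H →L[ℂ] H) (ξ n)),
    sq_nonneg (‖(x : H →L[ℂ] H) (ξ n)‖ - ‖(y : H →L[ℂ] H) (ξ n)‖)]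

/-- The ideal `I_ω` of the bounded sequences with `lim_ω ‖xₙ‖₂ = 0`. -/
def nullIdeal (τ : NormalTrace M) (ω : Ultrafilter ℕ) : Ideal (BddSeq M) where
  carrier := {x | Tendsto (fun n => norm₂ τ (x.1 n)) ω (𝓝 0)}
  zero_mem' := by
    have : (fun n => norm₂ τ ((0 : BddSeq M).1 n)) = fun _ => 0 := by
      funext n
      simp [norm₂]
    simp only [Set.mem_ofPred_eq, this]
    exact tendsto_const_nhds
  add_mem' := by
    intro x y hx hy
    have hs : Tendsto (fun n => norm₂ τ ((x + y).1 n) ^ 2) ω (𝓝 0) := by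
      refine squeeze_zero (fun n => sq_nonneg _)
        (fun n => norm₂_add_sq_le τ (x.1 n) (y.1 n)) ?_
      simpa using ((hx.pow 2).const_mul 2).add ((hy.pow 2).const_mul 2)
    have := hs.sqrt
    simpa [Real.sqrt_sq (norm₂_nonneg _ _)] using this
  smul_mem' := by
    intro c x hx
    obtain ⟨C, hC⟩ := c.2
    refine squeeze_zero (fun n => norm₂_nonneg _ _) (g := fun n => C * norm₂ τ (x.1 n))
      (fun n => (norm₂_mul_le τ (c.1 n) (x.1 n)).trans
        (mul_le_mul_of_nonneg_right (hC n) (norm₂_nonneg _ _))) ?_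
    simpa using hx.const_mul C

instance (τ : NormalTrace M) (ω : Ultrafilter ℕ) : (nullIdeal τ ω).IsTwoSided where
  mul_mem_of_left := by
    intro x c hx
    obtain ⟨C, hC⟩ := c.2
    refine squeeze_zero (fun n => norm₂_nonneg _ _) (g := fun n => C * norm₂ τ (x.1 n))
      (fun n => (norm₂_mul_le' τ (x.1 n) (c.1 n)).trans
        (mul_le_mul_of_nonneg_right (hC n) (norm₂_nonneg _ _))) ?_
    simpa using Tendsto.const_mul C hx

/-- The ultrapower `M^ω = ℓ^∞(ℕ, M) / I_ω`. -/
abbrev Ultrapower (τ : NormalTrace M) (ω : Ultrafilter ℕ) : Type u :=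
  BddSeq M ⧸ nullIdeal τ ω

/-- The quotient map `(xₙ) ↦ (xₙ)^ω`. -/
noncomputable def toUltrapower (τ : NormalTrace M) (ω : Ultrafilter ℕ) :
    BddSeq M →ₐ[ℂ] Ultrapower τ ω :=
  Ideal.Quotient.mkₐ ℂ (nullIdeal τ ω)

/-- The constant sequence `(a, a, …)`. -/
def constSeq (a : Elt M) : BddSeq M := ⟨fun _ => a, ‖a‖, fun _ => le_rfl⟩

/-- `N' ∩ M^ω`, where `M` (hence `N ⊆ M`) is embedded in `M^ω` by constant sequences. -/
noncomputable def commutantInUltrapower (τ : NormalTrace M) (ω : Ultrafilter ℕ)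
    (N : VonNeumannAlgebra H) : Subalgebra ℂ (Ultrapower τ ω) :=
  Subalgebra.centralizer ℂ
    {z | ∃ a : Elt M, (a : H →L[ℂ] H) ∈ N ∧ z = toUltrapower τ ω (constSeq a)}

/-- `P^ω` as a subalgebra of `M^ω`, for a subalgebra `P` of `M`: the classes of the bounded
sequences in `P`. -/
noncomputable def subUltrapower (τ : NormalTrace M) (ω : Ultrafilter ℕ)
    (P : StarSubalgebra ℂ (H →L[ℂ] H)) : Subalgebra ℂ (Ultrapower τ ω) :=
  Subalgebra.map (toUltrapower τ ω)
    { carrier := {x : BddSeq M | ∀ n, (x.1 n : H →L[ℂ] H) ∈ P}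
      mul_mem' := fun hx hy n => mul_mem (hx n) (hy n)
      add_mem' := fun hx hy n => add_mem (hx n) (hy n)
      algebraMap_mem' := fun c _ => algebraMap_mem P c }

end IIOne

/-! The space `L²(M, τ)` is an `N`-bimodule. Its `N`-central vectors form a closed subspace, and
property (T) gives a spectral gap on the orthogonal complement: a unit vector there almost commuting
with the `y j` would lie near a central unit vector, to which it is orthogonal. Hence commutators
with the `y j` control the norm on the complement (`exists_spectral_gap`).

To apply this to `x ∈ M`, the component of `x` along the central vectors must be a bounded operator,
so that it stays in `M`. The vector of minimal norm in a suitable conjugation-invariant convex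
subset of a ball of `M` gives `e ∈ N' ∩ M` with `‖e‖ ≤ ‖x‖` and `x - e` orthogonal to the central
vectors (`exists_relCommutant_sub_mem_orthogonal`). As `e` commutes with `N`, the elements `x` and
`x - e` have the same commutators with `N`, whence `‖x - e‖₂ ≤ C ∑ ‖[y j, x]‖₂`
(`exists_near_relCommutant`).

Applied termwise to sequences, this estimate gives the equality of ultrapowers. In the irreducible
case `e` is the scalar `τ(x)`, which excludes relative gamma. -/

namespace IIOne

variable {H : Type u} [NormedAddCommGroup H] [InnerProductSpace ℂ H] [CompleteSpace H]
variable {M : VonNeumannAlgebra H}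

/-! ### Amplification: a normal trace becomes a single vector functional. -/

/-- The Hilbert space `ℓ²(ℕ, H)`. -/
abbrev Amplified (H : Type u) [NormedAddCommGroup H] : Type u := lp (fun _ : ℕ => H) 2

theorem Amplified.norm_sq (v : Amplified H) : ‖v‖ ^ 2 = ∑' n, ‖v n‖ ^ 2 := by
  have := lp.norm_rpow_eq_tsum (p := 2) (by norm_num) v
  simpa using this

theorem Amplified.summable (v : Amplified H) : Summable fun n => ‖v n‖ ^ 2 := by
  have := (lp.memℓp v).summable (by norm_num)
  simpa using this

/-- A square summable sequence as a vector of `ℓ²(ℕ, H)`. -/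
def Amplified.mk (ξ : ℕ → H) (hξ : Summable fun n => ‖ξ n‖ ^ 2) : Amplified H :=
  ⟨ξ, memℓp_gen (by simpa using hξ)⟩

@[simp]
theorem Amplified.mk_apply (ξ : ℕ → H) (hξ : Summable fun n => ‖ξ n‖ ^ 2) (n : ℕ) :
    Amplified.mk ξ hξ n = ξ n := rfl

/-- The diagonal action of `B(H)` on `ℓ²(ℕ, H)`. -/
noncomputable def diag (x : H →L[ℂ] H) : Amplified H →L[ℂ] Amplified H :=
  LinearMap.mkContinuous
    { toFun := fun v => Amplified.mk (fun n => x (v n)) (summable_apply v.summable x)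
      map_add' := fun v w => by ext n; simp
      map_smul' := fun c v => by ext n; simp }
    ‖x‖ fun v => by
      refine le_of_sq_le_sq ?_ (by positivity)
      rw [mul_pow, Amplified.norm_sq, Amplified.norm_sq, ← tsum_mul_left]
      refine Summable.tsum_le_tsum (fun n => ?_) (summable_apply v.summable x)
        (v.summable.mul_left _)
      rw [← mul_pow]
      exact pow_le_pow_left₀ (norm_nonneg _) (x.le_opNorm _) 2

@[simp]
theorem diag_apply (x : H →L[ℂ] H) (v : Amplified H) (n : ℕ) : diag x v n = x (v n) := rfl

theorem diag_inner_left (x : H →L[ℂ] H) (v w : Amplified H) :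
    inner ℂ (diag (star x) v) w = inner ℂ v (diag x w) := by
  rw [lp.inner_eq_tsum, lp.inner_eq_tsum]
  exact tsum_congr fun n => ContinuousLinearMap.adjoint_inner_left _ _ _

/-! ### The space `L²(M, τ)` and its left action. -/

namespace NormalTrace

/-- The vector of `ℓ²(ℕ, H)` implementing the trace. -/
noncomputable def vec (τ : NormalTrace M) : Amplified H :=
  Amplified.mk τ.normal.choose τ.normal.choose_spec.1

theorem toLin_eq_inner (τ : NormalTrace M) (x : Elt M) :
    τ.toLin x = inner ℂ τ.vec (diag (x : H →L[ℂ] H) τ.vec) := by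
  rw [lp.inner_eq_tsum]
  exact τ.normal.choose_spec.2 x

/-- The orbit map `x ↦ x Ω` into `ℓ²(ℕ, H)`. -/
noncomputable def orbit (τ : NormalTrace M) : Elt M →ₗ[ℂ] Amplified H where
  toFun x := diag (x : H →L[ℂ] H) τ.vec
  map_add' _ _ := by ext n; simp
  map_smul' _ _ := by ext n; simp

theorem orbit_apply (τ : NormalTrace M) (x : Elt M) :
    τ.orbit x = diag (x : H →L[ℂ] H) τ.vec := rfl

theorem inner_orbit (τ : NormalTrace M) (x y : Elt M) :
    inner ℂ (τ.orbit x) (τ.orbit y) = τ.toLin (star x * y) := by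
  have h := diag_inner_left (star (x : H →L[ℂ] H)) τ.vec (τ.orbit y)
  rw [star_star] at h
  rw [toLin_eq_inner, orbit_apply, h]
  rfl

/-- The Hilbert space `L²(M, τ)`, as the closure of `M Ω` in `ℓ²(ℕ, H)`. -/
noncomputable def L2Submodule (τ : NormalTrace M) : Submodule ℂ (Amplified H) :=
  (LinearMap.range τ.orbit).topologicalClosure

/-- The Hilbert space `L²(M, τ)`. -/
abbrev L2 (τ : NormalTrace M) : Type u := τ.L2Submodule

instance (τ : NormalTrace M) : CompleteSpace τ.L2 :=
  (Submodule.isClosed_topologicalClosure _).completeSpace_coe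

/-- The embedding of `M` into `L²(M, τ)`. -/
noncomputable def toL2 (τ : NormalTrace M) : Elt M →ₗ[ℂ] τ.L2 :=
  τ.orbit.codRestrict τ.L2Submodule fun x =>
    Submodule.le_topologicalClosure _ (LinearMap.mem_range_self _ x)

theorem inner_toL2 (τ : NormalTrace M) (x y : Elt M) :
    inner ℂ (τ.toL2 x) (τ.toL2 y) = τ.toLin (star x * y) := τ.inner_orbit x y

theorem norm_toL2 (τ : NormalTrace M) (x : Elt M) : ‖τ.toL2 x‖ = norm₂ τ x := by
  rw [norm₂, ← inner_toL2]
  exact norm_eq_sqrt_re_inner (𝕜 := ℂ) _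

theorem denseRange_toL2 (τ : NormalTrace M) : DenseRange τ.toL2 := by
  intro v
  rw [closure_subtype]
  have h : ((↑) '' Set.range τ.toL2 : Set (Amplified H)) = LinearMap.range τ.orbit := by
    rw [← Set.range_comp]
    rfl
  rw [h]
  exact v.2

/-- This is faithfulness of the trace: the trace vector separates `M`. -/
theorem toL2_injective (τ : NormalTrace M) : Function.Injective τ.toL2 := by
  refine (injective_iff_map_eq_zero _).2 fun x hx => τ.faithful x ?_
  rw [← inner_toL2, hx, inner_zero_left]

/-- Left multiplication by `x ∈ M` on `L²(M, τ)`. -/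
noncomputable def leftMul (τ : NormalTrace M) (x : Elt M) : τ.L2 →L[ℂ] τ.L2 :=
  ((diag (x : H →L[ℂ] H)).comp τ.L2Submodule.subtypeL).codRestrict τ.L2Submodule fun v => by
    refine τ.denseRange_toL2.induction_on (p := fun v : τ.L2 =>
      diag (x : H →L[ℂ] H) v ∈ τ.L2Submodule) v ?_ ?_
    · exact (Submodule.isClosed_topologicalClosure _).preimage (by fun_prop)
    · exact fun y => (τ.toL2 (x * y)).2

@[simp]
theorem leftMul_toL2 (τ : NormalTrace M) (x y : Elt M) :
    τ.leftMul x (τ.toL2 y) = τ.toL2 (x * y) := rfl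

theorem inner_leftMul_star (τ : NormalTrace M) (x : Elt M) (v w : τ.L2) :
    inner ℂ (τ.leftMul (star x) v) w = inner ℂ v (τ.leftMul x w) :=
  diag_inner_left _ _ _

/-- Since `L2` sits inside `ℓ²(ℕ, H)`, the coordinates of `v` are themselves the required vectors of
`H`. -/
theorem isNormalPositive_leftMul (τ : NormalTrace M) (v : τ.L2) :
    IsNormalPositive M fun x => inner ℂ v (τ.leftMul x v) :=
  ⟨fun n => (v : Amplified H) n, Amplified.summable _, fun x => by
    exact lp.inner_eq_tsum (v : Amplified H) (diag (x : H →L[ℂ] H) v)⟩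

/-! ### Modular conjugation `J` and the right action `J x* J`. -/

/-- The modular conjugation `x Ω ↦ x* Ω` of `L²(M, τ)`. -/
noncomputable def conjL2 (τ : NormalTrace M) : τ.L2 →L⋆[ℂ] τ.L2 :=
  (τ.toL2.comp (starLinearEquiv ℂ (A := Elt M)).toLinearMap).extendOfNorm τ.toL2

@[simp]
theorem conjL2_toL2 (τ : NormalTrace M) (x : Elt M) :
    τ.conjL2 (τ.toL2 x) = τ.toL2 (star x) :=
  LinearMap.extendOfNorm_eq τ.denseRange_toL2
    ⟨1, fun x => by
      rw [one_mul, norm_toL2]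
      exact ((τ.norm_toL2 _).trans (norm₂_star τ x)).le⟩ x

@[simp]
theorem conjL2_conjL2 (τ : NormalTrace M) (v : τ.L2) : τ.conjL2 (τ.conjL2 v) = v := by
  refine τ.denseRange_toL2.induction_on v ?_ fun x => by simp
  exact isClosed_eq (by fun_prop) continuous_id

theorem inner_conjL2 (τ : NormalTrace M) (v w : τ.L2) :
    inner ℂ (τ.conjL2 v) (τ.conjL2 w) = inner ℂ w v := by
  refine τ.denseRange_toL2.induction_on v (isClosed_eq
    (τ.conjL2.continuous.inner continuous_const) (innerSL ℂ w).continuous) fun x => ?_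
  refine τ.denseRange_toL2.induction_on w (isClosed_eq
    (continuous_const.inner τ.conjL2.continuous) (innerSLFlip ℂ (τ.toL2 x)).continuous) fun y => ?_
  rw [conjL2_toL2, conjL2_toL2, inner_toL2, inner_toL2, star_star, τ.tracial]

/-- Right multiplication by `x ∈ M` on `L²(M, τ)`. -/
noncomputable def rightMul (τ : NormalTrace M) (x : Elt M) : τ.L2 →L[ℂ] τ.L2 :=
  τ.conjL2.comp ((τ.leftMul (star x)).comp τ.conjL2)

theorem rightMul_apply (τ : NormalTrace M) (x : Elt M) (v : τ.L2) :
    τ.rightMul x v = τ.conjL2 (τ.leftMul (star x) (τ.conjL2 v)) := rfl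

@[simp]
theorem rightMul_toL2 (τ : NormalTrace M) (x y : Elt M) :
    τ.rightMul x (τ.toL2 y) = τ.toL2 (y * x) := by
  simp [rightMul_apply]

/-- Carries normality from the left action to the right one: with `w = v` the right side is a vector
functional of the left action at `J v`. -/
theorem inner_rightMul (τ : NormalTrace M) (x : Elt M) (v w : τ.L2) :
    inner ℂ v (τ.rightMul x w) = inner ℂ (τ.conjL2 w) (τ.leftMul x (τ.conjL2 v)) := by
  rw [rightMul_apply, ← inner_leftMul_star, ← inner_conjL2, conjL2_conjL2]

theorem inner_rightMul_star (τ : NormalTrace M) (x : Elt M) (v w : τ.L2) :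
    inner ℂ (τ.rightMul (star x) v) w = inner ℂ v (τ.rightMul x w) := by
  rw [rightMul_apply, star_star, inner_rightMul, ← inner_conjL2, conjL2_conjL2]

theorem leftMul_rightMul (τ : NormalTrace M) (x y : Elt M) (v : τ.L2) :
    τ.leftMul x (τ.rightMul y v) = τ.rightMul y (τ.leftMul x v) := by
  refine τ.denseRange_toL2.induction_on v (isClosed_eq (by fun_prop) (by fun_prop)) fun z => ?_
  simp [mul_assoc]

/-- The left representation of `M` on `L²(M, τ)`. -/
noncomputable def leftRep (τ : NormalTrace M) : Elt M →⋆ₐ[ℂ] (τ.L2 →L[ℂ] τ.L2) where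
  toFun := τ.leftMul
  map_one' := rfl
  map_mul' _ _ := rfl
  map_zero' := rfl
  map_add' _ _ := rfl
  commutes' _ := rfl
  map_star' x := (ContinuousLinearMap.eq_adjoint_iff _ _).2 (τ.inner_leftMul_star x)

/-- The right representation of `M` on `L²(M, τ)`. -/
noncomputable def rightRep (τ : NormalTrace M) : (Elt M)ᵐᵒᵖ →⋆ₐ[ℂ] (τ.L2 →L[ℂ] τ.L2) where
  toFun x := τ.rightMul x.unop
  map_one' := by
    ext1 v
    rw [unop_one, rightMul_apply, star_one]
    exact τ.conjL2_conjL2 v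
  map_mul' x y := by
    ext1 v
    simp [rightMul_apply, star_mul]
    rfl
  map_zero' := by
    ext1 v
    rw [unop_zero, rightMul_apply, star_zero]
    exact map_zero τ.conjL2
  map_add' x y := by
    ext1 v
    rw [unop_add, rightMul_apply, star_add]
    exact map_add τ.conjL2 (τ.leftMul (star x.unop) _) (τ.leftMul (star y.unop) _)
  commutes' c := by
    ext1 v
    refine τ.denseRange_toL2.induction_on v (isClosed_eq (by fun_prop) (by fun_prop)) fun z => ?_
    rw [MulOpposite.algebraMap_apply, unop_op, rightMul_toL2, ← Algebra.commutes,
      ← Algebra.smul_def, map_smul]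
    rfl
  map_star' x := (ContinuousLinearMap.eq_adjoint_iff _ _).2 (τ.inner_rightMul_star x.unop)

end NormalTrace

/-! ### Closedness of operator-norm balls of `M` in `L²(M, τ)`. -/

namespace NormalTrace

theorem toL2_apply (τ : NormalTrace M) (x : Elt M) (n : ℕ) :
    (τ.toL2 x : Amplified H) n = (x : H →L[ℂ] H) (τ.vec n) := rfl

/-- The coordinates of the trace vector are jointly cyclic for the commutant of `M`. -/
theorem commutant_cyclic (τ : NormalTrace M) :
    (Submodule.span ℂ {v : H | ∃ b ∈ M.commutant, ∃ n, v = b (τ.vec n)}).topologicalClosure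
      = ⊤ := by
  set W := Submodule.span ℂ {v : H | ∃ b ∈ M.commutant, ∃ n, v = b (τ.vec n)} with hW
  set V := W.topologicalClosure with hV
  have : CompleteSpace V := (Submodule.isClosed_topologicalClosure _).completeSpace_coe
  -- `V` is invariant under `M'`, so its projection lies in `M'' = M`.
  have hp : V.starProjection ∈ M := by
    rw [VonNeumannAlgebra.IsStarProjection.mem_iff isStarProjection_starProjection]
    intro b hb
    rw [Submodule.range_starProjection, Module.End.mem_invtSubmodule_iff_forall_mem_of_mem]
    have hWb : ∀ v ∈ W, b v ∈ W := by
      intro v hv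
      refine Submodule.span_induction ?_ ?_ ?_ ?_ hv
      · rintro _ ⟨c, hc, n, rfl⟩
        exact Submodule.subset_span ⟨b * c, mul_mem hb hc, n, rfl⟩
      · simp
      · intro v w _ _ h1 h2
        rw [map_add]
        exact add_mem h1 h2
      · intro c v _ h
        rw [map_smul]
        exact W.smul_mem c h
    intro v hv
    exact map_mem_closure b.continuous hv hWb
  -- The complementary projection kills the trace vector, which separates `M`; hence it is zero and
  -- `V` is everything.
  have hq : τ.toL2 (1 - ⟨V.starProjection, hp⟩) = 0 := by
    ext n
    have hn : τ.vec n ∈ V := W.le_topologicalClosure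
      (Submodule.subset_span ⟨1, one_mem _, n, rfl⟩)
    have h2 := Submodule.starProjection_eq_self_iff.2 hn
    rw [toL2_apply]
    change τ.vec n - V.starProjection (τ.vec n) = 0
    rw [h2, sub_self]
  have h1 := τ.toL2_injective (hq.trans (map_zero τ.toL2).symm)
  have h3 : (1 : H →L[ℂ] H) = V.starProjection := congrArg Subtype.val (sub_eq_zero.1 h1)
  rw [Submodule.eq_top_iff']
  intro v
  rw [← Submodule.starProjection_eq_self_iff, ← h3]
  rfl

/-- An operator-norm bounded sequence in `M` which is Cauchy in `L²` converges strongly. -/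
theorem cauchySeq_apply (τ : NormalTrace M) {a : ℕ → Elt M} {r : ℝ} (hr : ∀ k, ‖a k‖ ≤ r)
    (ha : CauchySeq fun k => τ.toL2 (a k)) (v : H) :
    CauchySeq fun k => (a k : H →L[ℂ] H) v := by
  -- For `b ∈ M'`, `a k (b Ωₙ) = b (a k Ωₙ)`, and `a k Ωₙ` is a coordinate of the `L²`-Cauchy
  -- sequence.
  have hspan : ∀ w ∈ Submodule.span ℂ {v : H | ∃ b ∈ M.commutant, ∃ n, v = b (τ.vec n)},
      CauchySeq fun k => (a k : H →L[ℂ] H) w := by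
    intro w hw
    refine Submodule.span_induction ?_ ?_ ?_ ?_ hw
    · rintro _ ⟨b, hb, n, rfl⟩
      have h1 : CauchySeq _ := (b.comp ((lp.evalCLM ℂ (fun _ : ℕ => H) n (p := 2)).comp
        τ.L2Submodule.subtypeL)).uniformContinuous.comp_cauchySeq ha
      convert h1 using 1
      funext k
      have h2 := VonNeumannAlgebra.mem_commutant_iff.1 hb _ (a k).2
      exact congrArg (fun T : H →L[ℂ] H => T (τ.vec n)) h2
    · simpa using cauchySeq_const (0 : H)
    · intro v w _ _ h1 h2
      simp only [map_add]
      exact h1.add h2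
    · intro c v _ h
      simp only [map_smul]
      exact (uniformContinuous_const_smul c).comp_cauchySeq h
  have hr0 : 0 ≤ r := (norm_nonneg _).trans (hr 0)
  have hv : v ∈ closure (Submodule.span ℂ
      {v : H | ∃ b ∈ M.commutant, ∃ n, v = b (τ.vec n)} : Set H) := by
    rw [← Submodule.topologicalClosure_coe, τ.commutant_cyclic]
    trivial
  rw [Metric.cauchySeq_iff']
  intro ε hε
  -- An `ε/3` argument with the uniform norm bound; `r + 1` keeps the denominator nonzero when `r =
  -- 0`.
  obtain ⟨w, hw, hvw⟩ := Metric.mem_closure_iff.1 hv (ε / (3 * (r + 1))) (by positivity)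
  obtain ⟨n₀, h₀⟩ := Metric.cauchySeq_iff'.1 (hspan w hw) (ε / 3) (by positivity)
  have hb : ∀ k, dist ((a k : H →L[ℂ] H) v) ((a k : H →L[ℂ] H) w) < ε / 3 := by
    intro k
    rw [dist_eq_norm, ← map_sub]
    have h1 : ‖(a k : H →L[ℂ] H) (v - w)‖ ≤ (r + 1) * ‖v - w‖ :=
      ((a k : H →L[ℂ] H).le_opNorm _).trans
        (mul_le_mul_of_nonneg_right ((hr k).trans (by linarith)) (norm_nonneg _))
    refine h1.trans_lt ?_
    rw [dist_eq_norm, lt_div_iff₀ (by positivity)] at hvw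
    linarith
  refine ⟨n₀, fun k hk => ?_⟩
  have h1 := dist_triangle4 ((a k : H →L[ℂ] H) v) ((a k : H →L[ℂ] H) w)
    ((a n₀ : H →L[ℂ] H) w) ((a n₀ : H →L[ℂ] H) v)
  have h2 := hb n₀
  rw [dist_comm] at h2
  linarith [hb k, h₀ k hk]

/-- The operator-norm balls of `M` are closed in `L²(M, τ)`. -/
theorem isClosed_toL2_ball (τ : NormalTrace M) (r : ℝ) :
    IsClosed (τ.toL2 '' {a | ‖a‖ ≤ r}) := by
  refine IsSeqClosed.isClosed fun f ζ hf hζ => ?_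
  choose a ha hfa using hf
  obtain rfl : (fun k => τ.toL2 (a k)) = f := funext hfa
  choose T hT using fun v => cauchySeq_tendsto_of_complete (τ.cauchySeq_apply ha hζ.cauchySeq v)
  let S : H →L[ℂ] H := ContinuousLinearMap.ofTendstoOfBoundedRange T
    (fun k => (a k : H →L[ℂ] H)) (tendsto_pi_nhds.2 hT) (by
      refine isBounded_iff_forall_norm_le.2 ⟨r, ?_⟩
      rintro _ ⟨k, rfl⟩
      exact ha k)
  have hS : ∀ v, Tendsto (fun k => (a k : H →L[ℂ] H) v) atTop (𝓝 (S v)) := hT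
  have hr0 : 0 ≤ r := (norm_nonneg _).trans (ha 0)
  -- Strong limits preserve commutation with `M'`, so `S ∈ M'' = M`.
  have hSM : S ∈ M := by
    rw [← M.commutant_commutant, VonNeumannAlgebra.mem_commutant_iff]
    intro b hb
    ext v
    refine tendsto_nhds_unique ((b.continuous.tendsto _).comp (hS v)) ((hS (b v)).congr ?_)
    intro k
    exact congrArg (fun T : H →L[ℂ] H => T v)
      (VonNeumannAlgebra.mem_commutant_iff.1 hb _ (a k).2)
  refine ⟨⟨S, hSM⟩, ?_, ?_⟩
  · refine S.opNorm_le_bound hr0 fun v => ?_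
    exact le_of_tendsto (hS v).norm (Eventually.of_forall fun k =>
      ((a k : H →L[ℂ] H).le_opNorm v).trans
        (mul_le_mul_of_nonneg_right (ha k) (norm_nonneg _)))
  · ext n
    exact tendsto_nhds_unique (hS (τ.vec n))
      ((((lp.evalCLM ℂ (fun _ : ℕ => H) n (p := 2)).comp
        τ.L2Submodule.subtypeL).continuous.tendsto ζ).comp hζ)

/-! ### Central vectors and approximation by the relative commutant. -/

/-- The `N`-central vectors of `L²(M, τ)`. -/
noncomputable def central (τ : NormalTrace M) (N : VonNeumannAlgebra H) : Submodule ℂ τ.L2 where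
  carrier := {v | ∀ x : Elt M, (x : H →L[ℂ] H) ∈ N → τ.leftMul x v = τ.rightMul x v}
  add_mem' hv hw x hx := by rw [map_add, map_add, hv x hx, hw x hx]
  zero_mem' x _ := by rw [map_zero, map_zero]
  smul_mem' c v hv x hx := by rw [map_smul, map_smul, hv x hx]

theorem toL2_one_mem_central (τ : NormalTrace M) (N : VonNeumannAlgebra H) :
    τ.toL2 1 ∈ τ.central N := fun x _ => by simp

/-- Conjugation by a unitary of `N` does not change inner products with `N`-central vectors. -/
theorem inner_central_conj (τ : NormalTrace M) {N : VonNeumannAlgebra H} {v : τ.L2}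
    (hv : v ∈ τ.central N) {u : Elt M} (huN : (u : H →L[ℂ] H) ∈ N) (hu : star u * u = 1)
    (b : Elt M) : inner ℂ v (τ.toL2 (u * b * star u)) = inner ℂ v (τ.toL2 b) := by
  -- Moving the conjugation to the other side gives `u* v u`, which equals `v u* u = v` by
  -- centrality.
  rw [← rightMul_toL2, ← leftMul_toL2, ← inner_rightMul_star, star_star, ← inner_leftMul_star,
    leftMul_rightMul, hv (star u) (star_mem huN)]
  congr 1
  refine τ.denseRange_toL2.induction_on v (isClosed_eq (by fun_prop) (by fun_prop)) fun z => ?_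
  rw [rightMul_toL2, rightMul_toL2, mul_assoc, hu, mul_one]

end NormalTrace

/-- An operator commuting with the unitaries of `N` lies in the commutant of `N`. -/
theorem mem_commutant_of_forall_unitary {N : VonNeumannAlgebra H} {e : H →L[ℂ] H}
    (h : ∀ u ∈ N, star u * u = 1 → u * star u = 1 → u * e = e * u) : e ∈ N.commutant := by
  -- Norm closedness makes `Elt N` a C*-algebra, hence the linear span of its unitaries.
  have hcl : IsClosed (N.toStarSubalgebra : Set (H →L[ℂ] H)) := by
    rw [VonNeumannAlgebra.coe_toStarSubalgebra, ← N.centralizer_centralizer]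
    exact Set.isClosed_centralizer _
  rw [VonNeumannAlgebra.mem_commutant_iff]
  intro g hg
  have hspan : (⟨g, hg⟩ : Elt N) ∈ Submodule.span ℂ (unitary (Elt N) : Set (Elt N)) := by
    rw [CStarAlgebra.span_unitary (Elt N)]
    trivial
  refine Submodule.span_induction (p := fun (x : Elt N) _ =>
    (x : H →L[ℂ] H) * e = e * (x : H →L[ℂ] H)) ?_ ?_ ?_ ?_ hspan
  · intro u hu
    exact h u u.2 (congrArg Subtype.val hu.1) (congrArg Subtype.val hu.2)
  · simp
  · intro x y _ _ hx hy
    change ((x : H →L[ℂ] H) + y) * e = e * (x + y)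
    rw [add_mul, mul_add, hx, hy]
  · intro c x _ hx
    change (c • (x : H →L[ℂ] H)) * e = e * (c • (x : H →L[ℂ] H))
    rw [smul_mul_assoc, mul_smul_comm, hx]

/-- A nonempty closed convex subset of a Hilbert space has a unique vector of minimal norm. -/
theorem exists_unique_norm_minimizer {K : Type*} [NormedAddCommGroup K] [InnerProductSpace ℂ K]
    [CompleteSpace K] {S : Set K} (hne : S.Nonempty) (hclosed : IsClosed S)
    (hconv : ∀ v ∈ S, ∀ w ∈ S, ∀ s t : ℝ, 0 ≤ s → 0 ≤ t → s + t = 1 →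
      (s : ℂ) • v + (t : ℂ) • w ∈ S) :
    ∃ v ∈ S, ∀ w ∈ S, ‖w‖ ≤ ‖v‖ → w = v := by
  let _ : InnerProductSpace ℝ K := InnerProductSpace.rclikeToReal ℂ K
  have hconv' : Convex ℝ S := fun v hv w hw s t hs ht hst => hconv v hv w hw s t hs ht hst
  obtain ⟨v, hvS, hv⟩ :=
    exists_norm_eq_iInf_of_complete_convex hne hclosed.isComplete hconv' (0 : K)
  rw [norm_eq_iInf_iff_real_inner_le_zero hconv' hvS] at hv
  refine ⟨v, hvS, fun w hw hwv => ?_⟩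
  have h1 := hv w hw
  rw [zero_sub, inner_neg_left, inner_sub_right, real_inner_self_eq_norm_sq] at h1
  have h2 := norm_sub_sq_real w v
  rw [real_inner_comm] at h2
  -- Minimality gives `‖v‖² ≤ ⟪v, w⟫`, so `‖w - v‖² ≤ ‖w‖² - ‖v‖² ≤ 0`.
  have h3 : ‖w - v‖ ^ 2 ≤ 0 := by
    nlinarith [norm_nonneg w, norm_nonneg v]
  have h4 : ‖w - v‖ = 0 := by nlinarith [norm_nonneg (w - v)]
  exact sub_eq_zero.1 (norm_eq_zero.1 h4)

namespace NormalTrace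

/-- Every `a ∈ M` is, modulo the orthogonal complement of the `N`-central vectors, in `N' ∩ M`. -/
theorem exists_relCommutant_sub_mem_orthogonal (τ : NormalTrace M) {N : VonNeumannAlgebra H}
    (hNM : N ≤ M) (a : Elt M) : ∃ e : Elt M, (e : H →L[ℂ] H) ∈ N.commutant ∧ ‖e‖ ≤ ‖a‖ ∧
      τ.toL2 (a - e) ∈ (τ.central N)ᗮ := by
  -- The ball forces the minimizer to come from an operator in `M`. The orthogonality condition is
  -- preserved by unitary conjugation, so no convex hull of conjugates of `a` is needed.
  set S : Set τ.L2 := τ.toL2 '' {b | ‖b‖ ≤ ‖a‖} ∩ {v | τ.toL2 a - v ∈ (τ.central N)ᗮ} with hS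
  have hne : S.Nonempty := ⟨τ.toL2 a, ⟨a, le_refl ‖a‖, rfl⟩, by simp⟩
  have hclosed : IsClosed S := (τ.isClosed_toL2_ball _).inter
    ((Submodule.isClosed_orthogonal _).preimage (by fun_prop))
  have hconv : ∀ v ∈ S, ∀ w ∈ S, ∀ s t : ℝ, 0 ≤ s → 0 ≤ t → s + t = 1 →
      (s : ℂ) • v + (t : ℂ) • w ∈ S := by
    rintro _ ⟨⟨b, hb, rfl⟩, hb'⟩ _ ⟨⟨c, hc, rfl⟩, hc'⟩ s t hs ht hst
    refine ⟨⟨(s : ℂ) • b + (t : ℂ) • c, ?_, by rw [map_add, map_smul, map_smul]⟩, ?_⟩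
    · refine (norm_add_le _ _).trans ?_
      rw [norm_smul, norm_smul, Complex.norm_real, Complex.norm_real, Real.norm_of_nonneg hs,
        Real.norm_of_nonneg ht]
      have h1 := mul_le_mul_of_nonneg_left hb hs
      have h2 := mul_le_mul_of_nonneg_left hc ht
      calc s * ‖b‖ + t * ‖c‖ ≤ s * ‖a‖ + t * ‖a‖ := add_le_add h1 h2
        _ = ‖a‖ := by rw [← add_mul, hst, one_mul]
    · have h1 : τ.toL2 a - ((s : ℂ) • τ.toL2 b + (t : ℂ) • τ.toL2 c)
          = (s : ℂ) • (τ.toL2 a - τ.toL2 b) + (t : ℂ) • (τ.toL2 a - τ.toL2 c) := by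
        have h2 : τ.toL2 a = ((s : ℂ) + (t : ℂ)) • τ.toL2 a := by
          rw [← Complex.ofReal_add, hst, Complex.ofReal_one, one_smul]
        nth_rewrite 1 [h2]
        module
      change τ.toL2 a - ((s : ℂ) • τ.toL2 b + (t : ℂ) • τ.toL2 c) ∈ (τ.central N)ᗮ
      rw [h1]
      exact add_mem (Submodule.smul_mem _ _ hb') (Submodule.smul_mem _ _ hc')
  obtain ⟨v, hvS, huniq⟩ := exists_unique_norm_minimizer hne hclosed hconv
  obtain ⟨⟨e, he, rfl⟩, horth⟩ := hvS
  refine ⟨e, ?_, he, by rw [map_sub]; exact horth⟩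
  refine mem_commutant_of_forall_unitary fun u huN hu hu' => ?_
  set U : Elt M := ⟨u, hNM huN⟩ with hU
  have hUU : star U * U = 1 := Subtype.ext hu
  have hUU' : U * star U = 1 := Subtype.ext hu'
  have hU1 : ‖U‖ ≤ 1 := by
    have h1 := CStarRing.norm_star_mul_self (x := u)
    have h2 : ‖(1 : H →L[ℂ] H)‖ ≤ 1 := ContinuousLinearMap.norm_id_le
    rw [hu] at h1
    change ‖u‖ ≤ 1
    nlinarith [norm_nonneg u]
  have hU1' : ‖star U‖ ≤ 1 := by rwa [norm_star]
  -- Conjugation by `U` preserves `S` and does not increase `‖·‖₂`, so it fixes the unique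
  -- minimizer.
  have hconj : τ.toL2 (U * e * star U) = τ.toL2 e := by
    refine huniq _ ⟨⟨_, ?_, rfl⟩, ?_⟩ ?_
    · calc ‖U * e * star U‖ ≤ ‖U‖ * ‖e‖ * ‖star U‖ :=
            (norm_mul_le _ _).trans (mul_le_mul_of_nonneg_right (norm_mul_le _ _) (norm_nonneg _))
        _ ≤ 1 * ‖e‖ * 1 := by gcongr
        _ ≤ ‖a‖ := by rw [one_mul, mul_one]; exact he
    · rw [Set.mem_ofPred_eq, Submodule.mem_orthogonal] at horth ⊢
      intro k hk
      rw [inner_sub_right, τ.inner_central_conj hk huN hUU, ← inner_sub_right]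
      exact horth k hk
    · rw [norm_toL2, norm_toL2]
      calc norm₂ τ (U * e * star U) ≤ ‖star U‖ * norm₂ τ (U * e) := norm₂_mul_le' τ _ _
        _ ≤ 1 * (‖U‖ * norm₂ τ e) := by
            gcongr
            · exact norm₂_nonneg _ _
            · exact norm₂_mul_le τ _ _
        _ ≤ 1 * (1 * norm₂ τ e) := by
            gcongr
            exact norm₂_nonneg _ _
        _ = norm₂ τ e := by rw [one_mul, one_mul]
  have h1 := τ.toL2_injective hconj
  have h2 : U * e = e * U := by
    calc U * e = U * e * (star U * U) := by rw [hUU, mul_one]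
      _ = U * e * star U * U := by rw [mul_assoc (U * e)]
      _ = e * U := by rw [h1]
  exact congrArg Subtype.val h2

/-! ### Spectral gap from property (T). -/

/-- `L²(M, τ)` as an `N`-bimodule. -/
noncomputable def bimodule (τ : NormalTrace M) {N : VonNeumannAlgebra H} (hNM : N ≤ M) :
    Bimodule N τ.L2 where
  left := τ.leftRep.comp (StarSubalgebra.inclusion (S₁ := N.toStarSubalgebra) hNM)
  right := τ.rightRep.comp
    { AlgHom.op (StarSubalgebra.inclusion (S₁ := N.toStarSubalgebra) hNM).toAlgHom with
      map_star' := fun _ => rfl }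
  commute _ _ v := τ.leftMul_rightMul _ _ v
  normal_left v :=
    let ⟨ξ, hξ, h⟩ := τ.isNormalPositive_leftMul v
    ⟨ξ, hξ, fun x => h ⟨x, hNM x.2⟩⟩
  normal_right v :=
    let ⟨ξ, hξ, h⟩ := τ.isNormalPositive_leftMul (τ.conjL2 v)
    ⟨ξ, hξ, fun x => (τ.inner_rightMul ⟨x, hNM x.2⟩ v v).trans (h ⟨x, hNM x.2⟩)⟩

/-- Property (T) of `N` gives a spectral gap for commutators with finitely many elements of `N`
on the orthogonal complement of the `N`-central vectors of `L²(M, τ)`. -/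
theorem exists_spectral_gap (τ : NormalTrace M) {N : VonNeumannAlgebra H} (hNM : N ≤ M)
    (hT : HasPropertyT N) : ∃ (m : ℕ) (y : Fin m → Elt M) (C : ℝ),
      (∀ j, (y j : H →L[ℂ] H) ∈ N) ∧ ∀ v ∈ (τ.central N)ᗮ,
        ‖v‖ ≤ C * ∑ j, ‖τ.leftMul (y j) v - τ.rightMul (y j) v‖ := by
  obtain ⟨m, y, ε, C, hε, hC, h⟩ := hT
  -- Chosen so that `δ < ε` and `C * δ ≤ 1`, which is below the distance `√2` between orthogonal
  -- unit vectors.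
  set δ := min (ε / 2) (1 / C) with hδ
  have hδ0 : 0 < δ := lt_min (by positivity) (by positivity)
  have hδε : δ < ε := (min_le_left _ _).trans_lt (by linarith)
  have hCδ : C * δ ≤ 1 := by
    have := mul_le_mul_of_nonneg_left (min_le_right (ε / 2) (1 / C)) hC.le
    rwa [mul_one_div_cancel hC.ne'] at this
  refine ⟨m, fun j => ⟨y j, hNM (y j).2⟩, 1 / δ, fun j => (y j).2, fun v hv => ?_⟩
  rcases eq_or_ne v 0 with rfl | hv0
  · simp
  have hvn : 0 < ‖v‖ := norm_pos_iff.2 hv0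
  set c : ℂ := ((‖v‖⁻¹ : ℝ) : ℂ) with hc
  have hcn : ‖c‖ = ‖v‖⁻¹ := by
    rw [hc, Complex.norm_real, Real.norm_of_nonneg (inv_nonneg.2 hvn.le)]
  have hunit : ‖c • v‖ = 1 := by rw [norm_smul, hcn, inv_mul_cancel₀ hvn.ne']
  have hex : ∃ j, δ ≤ ‖τ.leftMul ⟨y j, hNM (y j).2⟩ (c • v)
      - τ.rightMul ⟨y j, hNM (y j).2⟩ (c • v)‖ := by
    by_contra! hcon
    obtain ⟨η, hη1, hη, hηv⟩ := h δ hδ0 hδε τ.L2 (τ.bimodule hNM) (c • v) hunit hcon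
    have hηc : η ∈ τ.central N := fun x hx => hη ⟨x, hx⟩
    have horth : inner ℂ η (c • v) = 0 :=
      (Submodule.mem_orthogonal _ _).1 (Submodule.smul_mem _ c hv) η hηc
    have h1 := norm_sub_sq (𝕜 := ℂ) η (c • v)
    rw [horth, hη1, hunit] at h1
    simp only [map_zero, mul_zero, sub_zero, one_pow] at h1
    nlinarith [norm_nonneg (η - c • v)]
  obtain ⟨j, hj⟩ := hex
  rw [map_smul, map_smul, ← smul_sub, norm_smul, hcn, inv_mul_eq_div, le_div_iff₀ hvn] at hj
  rw [one_div, inv_mul_eq_div, le_div_iff₀ hδ0, mul_comm]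
  exact hj.trans (Finset.single_le_sum (f := fun j => ‖τ.leftMul ⟨y j, hNM (y j).2⟩ v
      - τ.rightMul ⟨y j, hNM (y j).2⟩ v‖) (fun _ _ => norm_nonneg _) (Finset.mem_univ j))

/-- If `N ⊆ M` has property (T), then every `x ∈ M` almost commuting with a suitable finite subset
of `N` is close in `‖·‖₂` to an element of `N' ∩ M`, with a linear estimate. -/
theorem exists_near_relCommutant (τ : NormalTrace M) {N : VonNeumannAlgebra H} (hNM : N ≤ M)
    (hT : HasPropertyT N) : ∃ (m : ℕ) (y : Fin m → Elt M) (C : ℝ),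
      (∀ j, (y j : H →L[ℂ] H) ∈ N) ∧ ∀ x : Elt M, ∃ e : Elt M,
        (e : H →L[ℂ] H) ∈ N.commutant ∧ ‖e‖ ≤ ‖x‖ ∧ τ.toLin e = τ.toLin x ∧
        norm₂ τ (x - e) ≤ C * ∑ j, norm₂ τ (y j * x - x * y j) := by
  obtain ⟨m, y, C, hy, h⟩ := τ.exists_spectral_gap hNM hT
  refine ⟨m, y, C, hy, fun x => ?_⟩
  obtain ⟨e, heN, hex, he⟩ := τ.exists_relCommutant_sub_mem_orthogonal hNM x
  refine ⟨e, heN, hex, ?_, ?_⟩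
  · have h1 := (Submodule.mem_orthogonal _ _).1 he _ (τ.toL2_one_mem_central N)
    rw [inner_toL2, star_one, one_mul, map_sub, sub_eq_zero] at h1
    exact h1.symm
  · have h1 := h _ he
    rw [norm_toL2] at h1
    refine h1.trans_eq ?_
    congr 1
    refine Finset.sum_congr rfl fun j _ => ?_
    have hc : y j * e = e * y j :=
      Subtype.ext (VonNeumannAlgebra.mem_commutant_iff.1 heN _ (hy j))
    rw [leftMul_toL2, rightMul_toL2, ← map_sub, norm_toL2, mul_sub, sub_mul, hc]
    congr 1
    abel

end NormalTrace

/-! ### Relative commutants in the ultrapower. -/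

theorem toUltrapower_eq_iff {τ : NormalTrace M} {ω : Ultrafilter ℕ} {x y : BddSeq M} :
    toUltrapower τ ω x = toUltrapower τ ω y ↔
      Tendsto (fun n => norm₂ τ (x.1 n - y.1 n)) ω (𝓝 0) :=
  Ideal.Quotient.eq (I := nullIdeal τ ω)

theorem toUltrapower_surjective (τ : NormalTrace M) (ω : Ultrafilter ℕ) :
    Function.Surjective (toUltrapower τ ω) :=
  Ideal.Quotient.mk_surjective (I := nullIdeal τ ω)

theorem mem_subUltrapower_iff {τ : NormalTrace M} {ω : Ultrafilter ℕ}
    {P : StarSubalgebra ℂ (H →L[ℂ] H)} {z : Ultrapower τ ω} :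
    z ∈ subUltrapower τ ω P ↔
      ∃ x : BddSeq M, (∀ n, (x.1 n : H →L[ℂ] H) ∈ P) ∧ toUltrapower τ ω x = z := Iff.rfl

theorem mem_commutantInUltrapower_iff {τ : NormalTrace M} {ω : Ultrafilter ℕ}
    {N : VonNeumannAlgebra H} {x : BddSeq M} :
    toUltrapower τ ω x ∈ commutantInUltrapower τ ω N ↔
      ∀ a : Elt M, (a : H →L[ℂ] H) ∈ N →
        Tendsto (fun n => norm₂ τ (a * x.1 n - x.1 n * a)) ω (𝓝 0) := by
  rw [commutantInUltrapower, Subalgebra.mem_centralizer_iff]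
  have h (a : Elt M) : toUltrapower τ ω (constSeq a) * toUltrapower τ ω x
      = toUltrapower τ ω x * toUltrapower τ ω (constSeq a) ↔
        Tendsto (fun n => norm₂ τ (a * x.1 n - x.1 n * a)) ω (𝓝 0) := by
    rw [← map_mul, ← map_mul, toUltrapower_eq_iff]
    rfl
  constructor
  · exact fun hx a ha => (h a).1 (hx _ ⟨a, ha, rfl⟩)
  · rintro hx _ ⟨a, ha, rfl⟩
    exact (h a).2 (hx a ha)

/-- `(N' ∩ M)^ω ⊆ N' ∩ M^ω`. -/
theorem subUltrapower_relCommutant_le (τ : NormalTrace M) (ω : Ultrafilter ℕ)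
    (N : VonNeumannAlgebra H) :
    subUltrapower τ ω (relCommutant N M) ≤ commutantInUltrapower τ ω N := by
  intro z hz
  obtain ⟨x, hx, rfl⟩ := mem_subUltrapower_iff.1 hz
  refine mem_commutantInUltrapower_iff.2 fun a ha => ?_
  have h (n : ℕ) : norm₂ τ (a * x.1 n - x.1 n * a) = 0 := by
    have h1 : a * x.1 n = x.1 n * a :=
      Subtype.ext (VonNeumannAlgebra.mem_commutant_iff.1 (hx n).1 _ ha)
    rw [h1, sub_self, ← τ.norm_toL2, map_zero, norm_zero]
  simp only [h]
  exact tendsto_const_nhds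

/-- If `N` has property (T), then `N' ∩ M^ω = (N' ∩ M)^ω`. -/
theorem commutantInUltrapower_eq (τ : NormalTrace M) (ω : Ultrafilter ℕ)
    {N : VonNeumannAlgebra H} (hNM : N ≤ M) (hT : HasPropertyT N) :
    commutantInUltrapower τ ω N = subUltrapower τ ω (relCommutant N M) := by
  refine le_antisymm (fun z hz => ?_) (subUltrapower_relCommutant_le τ ω N)
  obtain ⟨x, rfl⟩ := toUltrapower_surjective τ ω z
  rw [mem_commutantInUltrapower_iff] at hz
  obtain ⟨m, y, C, hy, h⟩ := τ.exists_near_relCommutant hNM hT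
  choose e heN hex _ he using h
  obtain ⟨D, hD⟩ := x.2
  -- The bound `‖e‖ ≤ ‖x‖` keeps the approximating sequence in `ℓ^∞(ℕ, M)`.
  refine mem_subUltrapower_iff.2 ⟨⟨fun n => e (x.1 n), D, fun n => (hex _).trans (hD n)⟩,
    fun n => ⟨heN _, (e (x.1 n)).2⟩, Eq.symm (toUltrapower_eq_iff.2 ?_)⟩
  refine squeeze_zero (fun n => norm₂_nonneg _ _) (fun n => he (x.1 n)) ?_
  have h1 := (tendsto_finsetSum Finset.univ fun j _ => hz (y j) (hy j)).const_mul C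
  simpa using h1

/-- For an irreducible subfactor `N` of `M`, the relative commutant `N' ∩ M` is trivial. -/
theorem IsIrreducibleIn.exists_eq_smul_one {N : VonNeumannAlgebra H} (hirr : IsIrreducibleIn N M)
    (hN : IsFactor N) {x : H →L[ℂ] H} (hxM : x ∈ M) (hxN : x ∈ N.commutant) :
    ∃ c : ℂ, x = c • (1 : H →L[ℂ] H) :=
  hN x (hirr x hxM hxN) hxN

/-- The ultrapower of the scalars is trivial. -/
theorem subUltrapower_eq_bot (τ : NormalTrace M) (ω : Ultrafilter ℕ)
    {P : StarSubalgebra ℂ (H →L[ℂ] H)} (hP : ∀ x ∈ P, ∃ c : ℂ, x = c • (1 : H →L[ℂ] H)) :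
    subUltrapower τ ω P = ⊥ := by
  refine eq_bot_iff.2 fun z hz => ?_
  obtain ⟨x, hx, rfl⟩ := mem_subUltrapower_iff.1 hz
  choose c hc using fun n => hP _ (hx n)
  have hxc (n : ℕ) : x.1 n = c n • (1 : Elt M) := Subtype.ext (hc n)
  obtain ⟨D, hD⟩ := x.2
  have hone : norm₂ τ (1 : Elt M) = 1 := by
    rw [norm₂, star_one, one_mul, τ.map_one, Complex.one_re, Real.sqrt_one]
  have hsmul (t : ℂ) : norm₂ τ (t • (1 : Elt M)) = ‖t‖ := by
    rw [← τ.norm_toL2, map_smul, norm_smul, τ.norm_toL2, hone, mul_one]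
  have hcD (n : ℕ) : c n ∈ Metric.closedBall (0 : ℂ) D := by
    rw [mem_closedBall_zero_iff, ← hsmul, ← hxc]
    have h1 := norm₂_mul_le τ (x.1 n) 1
    rw [hone, mul_one, mul_one] at h1
    exact h1.trans (hD n)
  -- A bounded scalar sequence converges along `ω`; its limit represents the class.
  obtain ⟨t, -, ht⟩ := (isCompact_closedBall (0 : ℂ) D).ultrafilter_le_nhds (ω.map c)
    (le_principal_iff.2 (Filter.mem_map.2 (Filter.univ_mem' hcD)))
  have ht' : Tendsto c ω (𝓝 t) := ht
  refine Algebra.mem_bot.2 ⟨t, ?_⟩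
  rw [← (toUltrapower τ ω).commutes t, eq_comm, toUltrapower_eq_iff]
  have h1 (n : ℕ) : norm₂ τ (x.1 n - (algebraMap ℂ (BddSeq M) t).1 n) = ‖c n - t‖ := by
    have h2 : (algebraMap ℂ (BddSeq M) t).1 n = t • (1 : Elt M) :=
      Algebra.algebraMap_eq_smul_one (A := Elt M) t
    rw [h2, hxc, ← sub_smul, hsmul]
  simp only [h1]
  exact tendsto_iff_norm_sub_tendsto_zero.1 ht'

/-! ### Failure of relative property gamma. -/

/-- An irreducible subfactor with property (T) does not have relative property gamma. -/
theorem not_hasRelativeGamma (τ : NormalTrace M) {N : VonNeumannAlgebra H} (hNM : N ≤ M)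
    (hT : HasPropertyT N) (hN : IsFactor N) (hirr : IsIrreducibleIn N M) :
    ¬ HasRelativeGamma τ N := by
  intro hΓ
  classical
  obtain ⟨m, y, C, hy, h⟩ := τ.exists_near_relCommutant hNM hT
  obtain ⟨x, -, hx1, hxE, hx⟩ := hΓ (Finset.univ.image y) (by simpa using hy)
  -- `E_N(x n) = 0` forces `τ(x n) = 0`; the approximant `e` is a scalar of the same trace, hence
  -- zero, so the estimate bounds `‖x n‖₂ = 1` itself.
  have hle (n : ℕ) : 1 ≤ C * ∑ j, norm₂ τ (y j * x n - x n * y j) := by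
    obtain ⟨e, heN, -, heτ, he⟩ := h (x n)
    have h0 : τ.toLin (x n) = 0 := by
      have h1 := (hxE n).2 1 (one_mem N)
      rw [zero_mul, map_zero, mul_one] at h1
      exact h1.symm
    obtain ⟨c, hc⟩ := hirr.exists_eq_smul_one hN e.2 heN
    have hc' : e = c • (1 : Elt M) := Subtype.ext hc
    rw [hc', map_smul, τ.map_one, h0, smul_eq_mul, mul_one] at heτ
    rw [hc', heτ, zero_smul, sub_zero, hx1] at he
    exact he
  have hlim := (tendsto_finsetSum Finset.univ fun j _ =>
    hx (y j) (Finset.mem_image_of_mem y (Finset.mem_univ j))).const_mul C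
  have h1 := ge_of_tendsto' hlim hle
  rw [Finset.sum_const_zero, mul_zero] at h1
  linarith

end IIOne

theorem mainTheorem5 {H : Type*} [NormedAddCommGroup H] [InnerProductSpace ℂ H] [CompleteSpace H]
    (M N : VonNeumannAlgebra H) (hNM : N ≤ M)
    (hM : IIOne.IsTypeIIOneFactor M) (hN : IIOne.IsTypeIIOneFactor N)
    (τ : IIOne.NormalTrace M) (hT : IIOne.HasPropertyT N) :
    (∀ ω : Ultrafilter ℕ, (ω : Filter ℕ) ≤ Filter.cofinite →
      IIOne.commutantInUltrapower τ ω N =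
        IIOne.subUltrapower τ ω (IIOne.relCommutant N M)) ∧
    (IIOne.IsIrreducibleIn N M →
      (∀ ω : Ultrafilter ℕ, (ω : Filter ℕ) ≤ Filter.cofinite →
        IIOne.commutantInUltrapower τ ω N = ⊥) ∧
      ¬ IIOne.HasRelativeGamma τ N) := by
  refine ⟨fun ω _ => IIOne.commutantInUltrapower_eq τ ω hNM hT, fun hirr =>
    ⟨fun ω _ => ?_, IIOne.not_hasRelativeGamma τ hNM hT hN.1 hirr⟩⟩
  rw [IIOne.commutantInUltrapower_eq τ ω hNM hT]
  exact IIOne.subUltrapower_eq_bot τ ω fun x hx => hirr.exists_eq_smul_one hN.1 hx.2 hx.1
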